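/- A three-step path is a lattice path consisting of up-steps $(1,1)$, level steps $(1,0)$ and down-steps $(1,-1)$. For non-negative integers $m,k$ let $MP_m(k)$ denote the number of three-step paths with $m$ steps that start at $(0,k)$, never run below the $x$-axis, and have arbitrary end point. For integers $a,b$ let $\binom{m}{a,b}=\frac{m!}{a!\,b!\,(m-a-b)!}$, which is understood to be $0$ if one of $a$, $b$, $m-a-b$ is negative. Then, for all positive integers $n$ and non-negative integers $k$, $$\det_{0\le i,j\le n-1}\bigl(MP_{i+j+1}(k)\bigr)=\det_{0\le i,j\le n-1}\left(\sum_{\ell\ge0}\sum_{l=-k}^{k+1}\binom{i+j+1}{\ell,\ell+l}\right)$$ $$=\begin{cases} (-1)^{n_1\binom{k+2}2}, & \text{if } n=(k+1)n_1 \text{ and } k\equiv2\pmod 3,\\ (-1)^{n_1\binom{k+2}2}, & \text{if } n=(3k+3)n_1 \text{ and } k\not\equiv2\pmod 3,\\ 2(-1)^{(n_1+1)\binom{k+2}2+1}, & \text{if } n=(3k+3)n_1+k+1 \text{ and } k\not\equiv2\pmod 3,\\ (-1)^{n_1\binom{k+2}2}, & \text{if } n=(3k+3)n_1+2k+2 \text{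 and } k\not\equiv2\pmod 3,\\ 3(-1)^{n_1\binom{k+2}2}(n_1+1), & \text{if } n=(k+1)n_1+1 \text{ and } k\equiv2\pmod 3,\\ 3(-1)^{n_1\binom{k+2}2}, & \text{if } n=(3k+3)n_1+1 \text{ and } k\not\equiv2\pmod 3,\\ 3(-1)^{(n_1+1)\binom{k+2}2+1}, & \text{if } n=(3k+3)n_1+k+2 \text{ and } k\not\equiv2\pmod 3,\\ 3(-1)^{(n_1+1)\binom{k+2}2+1}(n_1+1), & \text{if } n=(k+1)n_1+k \text{ and } k\equiv2\pmod 3,\\ 3(-1)^{(n_1+1)\binom{k+2}2+1}, & \text{if } n=(3k+3)n_1+k \text{ and } k\not\equiv2\pmod 3,\\ 3(-1)^{n_1\binom{k+2}2}, & \text{if } n=(3k+3)n_1+2k+1 \text{ and } k\not\equiv2\pmod 3,\\ 0, & \text{otherwise,} \end{cases}$$ where $n_1$ denotes a non-negative integer and where, if several cases apply (which happens only for $k\in\{0,1\}$), the first applicable one is to be taken. -/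

import Mathlib

/-- The height after the first `m` steps of the three-step path with `n` steps that starts at
height `k` and whose `i`-th step is `(1, s i)`; here `SignType` is the set `{-1, 0, 1}`, so that
the steps are the down-step, the level step and the up-step. -/
def pathHeight (k : ℕ) {n : ℕ} (s : Fin n → SignType) (m : ℕ) : ℤ :=
  (k : ℤ) + ∑ i ∈ Finset.univ.filter (fun i : Fin n => i.val < m), (s i : ℤ)

/-- The generalised Motzkin prefix number `MP_n(k)`: the number of three-step paths with `n` steps
that start at `(0, k)`, end at any height, and never run below the `x`-axis. -/
def motzkinPrefix (n k : ℕ) : ℕ :=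
  Fintype.card {s : Fin n → SignType // ∀ m : Fin (n + 1), 0 ≤ pathHeight k s m}

/-- The trinomial coefficient `n! / (a! b! (n - a - b)!)`, which is zero as soon as one of
`a`, `b`, `n - a - b` is negative. (The division of natural numbers is exact.) -/
def trinomial (n : ℕ) (a b : ℤ) : ℕ :=
  if 0 ≤ a ∧ 0 ≤ b ∧ a + b ≤ n then
    n.factorial / (a.toNat.factorial * b.toNat.factorial * ((n : ℤ) - a - b).toNat.factorial)
  else 0

/-- The sum `∑_{r ≥ 0} ∑_{l = -k}^{k + 1}` of the trinomial coefficients of `n` with lower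
entries `r` and `r + l`. -/
noncomputable def trinomialSum (n k : ℕ) : ℕ :=
  ∑ᶠ r : ℕ, ∑ l ∈ Finset.Icc (-(k : ℤ)) ((k : ℤ) + 1), trinomial n (r : ℤ) ((r : ℤ) + l)

/-- The sum over `r` has only finitely many non-zero terms. -/
theorem trinomialSum_support_finite (n k : ℕ) :
    (Function.support fun r : ℕ =>
      ∑ l ∈ Finset.Icc (-(k : ℤ)) ((k : ℤ) + 1), trinomial n (r : ℤ) ((r : ℤ) + l)).Finite := by
  refine (Finset.range (n + 1)).finite_toSet.subset fun r hr => ?_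
  by_contra hlt
  refine hr (Finset.sum_eq_zero fun l _ => ?_)
  have : n < r := by simpa using hlt
  unfold trinomial
  rw [if_neg]
  omega

/-!
Let `L` be the linear functional on `ℤ[X]` whose moments in `x + 1` count the three-step paths from
height `0`. The recurrence for paths by their first step is the Chebyshev recurrence, so
`L(S_k (x + 1)^m) = MP_m(k)`, while the polynomials `V_n = S_n - S_{n-1}` are orthonormal for `L`.
The determinant therefore consists of the moments of the functional `p ↦ L((x + 1) S_k p)`, and it
is, up to sign, the determinant of the residues of `V_n, …, V_{n+k}` modulo `(x + 1) S_k` written in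
the basis `V_0, …, V_k`: both express the change of basis from `V_0, …, V_{n+k}` to
`V_0, …, V_k, (x + 1) S_k, …, x^{n-1} (x + 1) S_k`.

The identity `V_{m+d} - V_{m-d} = S_{d-1} (C_{m+1} - C_m)` with `d = k + 1` reduces each `V_m` to
some `V_j` plus a multiple of `S_k = V_0 + ⋯ + V_k`, so the residue matrix is the matrix of a map
of `{0, …, k}` to itself plus a matrix with constant rows. It is singular when that map repeats two
values; otherwise its determinant is, up to sign, a factor `1` or `3` times the value of a
Chebyshev polynomial at `C_{k+1}(-1)`, which is `2` or `-1` according as `k ≡ 2 (mod 3)` or not.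
-/

section Determinants

open Polynomial

variable {R : Type*} [CommRing R]

theorem det_apply_eq_det_apply_X_pow {N : ℕ} (φ : Fin N → R[X] →ₗ[R] R) {p : Fin N → R[X]}
    (hp : ∀ i, IsMonicOfDegree (p i) i) :
    (Matrix.of fun i j => φ j (p i)).det =
      (Matrix.of fun i j : Fin N => φ j (X ^ (i : ℕ))).det := by
  have hfactor : (Matrix.of fun i j => φ j (p i)) =
      (Matrix.of fun i j : Fin N => (p j).coeff i).transpose *
        Matrix.of fun i j : Fin N => φ j (X ^ (i : ℕ)) := by
    ext i j
    simp only [Matrix.mul_apply, Matrix.transpose_apply, Matrix.of_apply]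
    conv_lhs => rw [(p i).as_sum_range' N ((hp i).natDegree_eq.trans_lt i.2)]
    simp only [map_sum, Finset.sum_range, ← smul_X_eq_monomial, map_smul, smul_eq_mul]
  rw [hfactor, Matrix.det_mul, Matrix.det_transpose,
    Matrix.det_matrixOfPolynomials p (fun i => (hp i).natDegree_eq) fun i => (hp i).monic, one_mul]

theorem finRotate_pow_val (N k : ℕ) (b : Fin N) : ((finRotate N ^ k) b : ℕ) = (b + k) % N := by
  have := b.neZero
  induction k with
  | zero => simp [Nat.mod_eq_of_lt b.2]
  | succ k ih =>
    rw [pow_succ', Equiv.Perm.mul_apply, finRotate_apply, Fin.val_add, ih, Fin.val_one',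
      ← Nat.add_mod, add_assoc]

theorem sign_finRotate_pow (n d : ℕ) :
    Equiv.Perm.sign (finRotate (n + d) ^ d) = (-1) ^ (n * d) := by
  rcases d with _ | d
  · simp
  · rw [map_pow, sign_finRotate, ← pow_mul, show (n + (d + 1) - 1) * (d + 1) =
      d * (d + 1) + n * (d + 1) by rw [← add_assoc, Nat.add_sub_cancel]; ring, pow_add,
      (Nat.even_mul_succ_self d).neg_one_pow, one_mul]

theorem finRotate_pow_finSumFinEquiv (n d : ℕ) (a : Fin n ⊕ Fin d) :
    ((finRotate (n + d) ^ d) (finSumFinEquiv a) : ℕ) =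
      Sum.elim (fun i : Fin n => d + (i : ℕ)) (fun i : Fin d => (i : ℕ)) a := by
  rw [finRotate_pow_val]
  rcases a with i | i
  · rw [finSumFinEquiv_apply_left, Fin.val_castAdd, Sum.elim_inl, Nat.mod_eq_of_lt (by omega),
      add_comm]
  · rw [finSumFinEquiv_apply_right, Fin.val_natAdd, Sum.elim_inr, add_right_comm,
      Nat.add_mod_left, Nat.mod_eq_of_lt (by omega)]

variable {V : ℕ → R[X]} {φ : ℕ → R[X] →ₗ[R] R}

theorem det_apply_eq_one (hφ : ∀ i j, j < i → φ j (V i) = 0) (hφV : ∀ i, φ i (V i) = 1)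
    (s N : ℕ) : (Matrix.of fun i j : Fin N => φ (s + j) (V (s + i))).det = 1 := by
  refine (Matrix.det_of_isUpperTriangular fun i j hij =>
    hφ _ _ (Nat.add_lt_add_left (Fin.lt_def.mp hij) s)).trans ?_
  simp [hφV]

theorem det_apply_mul_X_pow_sumElim (hV : ∀ i, IsMonicOfDegree (V i) i)
    (hφ : ∀ i j, j < i → φ j (V i) = 0) (hφV : ∀ i, φ i (V i) = 1)
    {q : R[X]} {d : ℕ} (hq : IsMonicOfDegree q d) (n : ℕ) :
    (Matrix.of fun a b : Fin n ⊕ Fin d => φ (finSumFinEquiv b : Fin (n + d))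
      (Sum.elim (fun i : Fin n => q * X ^ (i : ℕ)) (fun i : Fin d => V i) a)).det =
      (-1) ^ (n * d) := by
  nontriviality R
  set p : Fin n ⊕ Fin d → R[X] := Sum.elim (fun i => q * X ^ (i : ℕ)) (fun i => V i)
  set σ := finRotate (n + d) ^ d
  set e : Fin n ⊕ Fin d ≃ Fin (n + d) := finSumFinEquiv.trans σ
  have hpe : ∀ a, IsMonicOfDegree (p a) (e a) := fun a => by
    rw [Equiv.trans_apply, finRotate_pow_finSumFinEquiv]
    rcases a with i | i
    · exact hq.mul (isMonicOfDegree_X_pow R i)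
    · exact hV i
  have hsorted : (Matrix.of fun i j : Fin (n + d) => φ j (p (e.symm i))).det = 1 := by
    rw [det_apply_eq_det_apply_X_pow (fun j : Fin (n + d) => φ j)
      fun i => by simpa using hpe (e.symm i),
      ← det_apply_eq_det_apply_X_pow (fun j : Fin (n + d) => φ j) fun i : Fin (n + d) => hV i]
    simpa using det_apply_eq_one hφ hφV 0 (n + d)
  have hperm := Matrix.det_permute σ (Matrix.of fun i j : Fin (n + d) => φ j (p (e.symm i)))
  rw [hsorted, mul_one, sign_finRotate_pow,
    ← Matrix.det_submatrix_equiv_self finSumFinEquiv] at hperm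
  refine Eq.trans (congrArg Matrix.det ?_) (hperm.trans (by push_cast; rfl))
  ext a b
  simp [e]

theorem det_apply_sumElim_add (hφ : ∀ i j, j < i → φ j (V i) = 0) (hφV : ∀ i, φ i (V i) = 1)
    {n : ℕ} (p : Fin n → R[X]) (d : ℕ) :
    (Matrix.of fun a b : Fin n ⊕ Fin d => φ (finSumFinEquiv b : Fin (n + d))
      (Sum.elim p (fun i : Fin d => V (n + i)) a)).det =
      (Matrix.of fun i j : Fin n => φ j (p i)).det := by
  have hblocks : (Matrix.of fun a b : Fin n ⊕ Fin d => φ (finSumFinEquiv b : Fin (n + d))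
      (Sum.elim p (fun i : Fin d => V (n + i)) a)) =
      Matrix.fromBlocks (Matrix.of fun i (j : Fin n) => φ j (p i))
        (Matrix.of fun i (j : Fin d) => φ (n + j) (p i)) 0
        (Matrix.of fun i j : Fin d => φ (n + j) (V (n + i))) := by
    ext (i | i) (j | j)
    · simp
    · simp
    · simp [hφ (n + i) j (by omega)]
    · simp
  rw [hblocks, Matrix.det_fromBlocks_zero₂₁, det_apply_eq_one hφ hφV, mul_one]

theorem exists_eq_sum_smul_mul_X_pow_add {q p r : R[X]} {n d : ℕ} (hq : IsMonicOfDegree q d)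
    (hp : p ∈ degreeLT R (n + d)) (hr : r ∈ degreeLT R (n + d)) (h : q ∣ p - r) :
    ∃ c : Fin n → R, p = ∑ j, c j • (q * X ^ (j : ℕ)) + r := by
  nontriviality R
  obtain ⟨Q, hQ⟩ := h
  have hdeg : Q.degree < n := by
    have := mem_degreeLT.mp (hQ ▸ sub_mem hp hr)
    rw [mul_comm, hq.monic.degree_mul, degree_eq_natDegree hq.monic.ne_zero, hq.natDegree_eq,
      Nat.cast_add] at this
    exact lt_of_add_lt_add_right this
  have hQsum : Q = ∑ j : Fin n, Q.coeff j • X ^ (j : ℕ) := by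
    conv_lhs => rw [← sum_C_mul_X_pow_eq Q, ← sum_fin _ (by simp) hdeg]
    simp only [smul_eq_C_mul]
  refine ⟨fun j => Q.coeff j, ?_⟩
  rw [← sub_eq_iff_eq_add, hQ]
  conv_lhs => rw [hQsum]
  simp only [Finset.mul_sum, mul_smul_comm]

theorem det_apply_mul_X_pow (hV : ∀ i, IsMonicOfDegree (V i) i)
    (hφ : ∀ i j, j < i → φ j (V i) = 0) (hφV : ∀ i, φ i (V i) = 1)
    {q : R[X]} {d : ℕ} (hq : IsMonicOfDegree q d) (n : ℕ) {M : Matrix (Fin d) (Fin d) R}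
    (hM : ∀ i : Fin d, q ∣ V (n + i) - ∑ j, M i j • V j) :
    (Matrix.of fun i j : Fin n => φ j (q * X ^ (i : ℕ))).det = (-1) ^ (n * d) * M.det := by
  nontriviality R
  have hdeg : ∀ i < n + d, V i ∈ degreeLT R (n + d) := fun i hi => by
    rw [mem_degreeLT, degree_eq_natDegree (hV i).monic.ne_zero, (hV i).natDegree_eq]
    exact_mod_cast hi
  have hexpand : ∀ i : Fin d, ∃ c : Fin n → R,
      V (n + i) = ∑ j, c j • (q * X ^ (j : ℕ)) + ∑ j, M i j • V j := fun i =>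
    exists_eq_sum_smul_mul_X_pow_add hq (hdeg _ (by omega))
      (sum_mem fun j _ => Submodule.smul_mem _ _ (hdeg j (by omega))) (hM i)
  choose c hc using hexpand
  rw [← det_apply_sumElim_add hφ hφV (fun i : Fin n => q * X ^ (i : ℕ)) d,
    ← det_apply_mul_X_pow_sumElim hV hφ hφV hq n, mul_comm]
  have hreduce : (Matrix.of fun a b : Fin n ⊕ Fin d => φ (finSumFinEquiv b : Fin (n + d))
      (Sum.elim (fun i : Fin n => q * X ^ (i : ℕ)) (fun i : Fin d => V (n + i)) a)) =
      Matrix.fromBlocks 1 0 (Matrix.of c) M *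
        Matrix.of fun a b : Fin n ⊕ Fin d => φ (finSumFinEquiv b : Fin (n + d))
          (Sum.elim (fun i : Fin n => q * X ^ (i : ℕ)) (fun i : Fin d => V i) a) := by
    ext (i | i) b
    · simp [Matrix.mul_apply, Matrix.one_apply]
    · simp [Matrix.mul_apply, hc i]
  rw [hreduce, Matrix.det_mul, Matrix.det_fromBlocks_zero₁₂, Matrix.det_one, one_mul]

end Determinants

section Chebyshev

open Polynomial

variable (R : Type*) [CommRing R]

/-- The rescaled Chebyshev polynomials of the third kind, with
`V_n(2 cos t) = cos ((n + 1 / 2) t) / cos (t / 2)`; like `Chebyshev.S` and `Chebyshev.C`, which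
are rescaled in the same way, they are indexed by all integers. -/
noncomputable def chebyshevV (n : ℤ) : R[X] := Chebyshev.S R n - Chebyshev.S R (n - 1)

theorem chebyshevV_zero : chebyshevV R 0 = 1 := by simp [chebyshevV]

theorem chebyshevV_one : chebyshevV R 1 = X - 1 := by simp [chebyshevV]

theorem chebyshevV_neg_one_sub (n : ℤ) : chebyshevV R (-1 - n) = chebyshevV R n := by
  have hS := Chebyshev.S_neg_sub_two R (n - 1)
  rw [show -(n - 1) - 2 = -1 - n by ring] at hS
  rw [chebyshevV, chebyshevV, hS, show -1 - n - 1 = -n - 2 by ring, Chebyshev.S_neg_sub_two]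
  ring

theorem sum_range_chebyshevV (d : ℕ) :
    ∑ i ∈ Finset.range d, chebyshevV R i = Chebyshev.S R (d - 1) := by
  simpa [chebyshevV] using Finset.sum_range_sub (fun i : ℕ => Chebyshev.S R (i - 1)) d

theorem isMonicOfDegree_chebyshevS [Nontrivial R] (n : ℕ) :
    IsMonicOfDegree (Chebyshev.S R n) n := by
  induction n using Nat.twoStepInduction with
  | zero => simp
  | one => simpa using isMonicOfDegree_X R
  | more n ihn ihn1 =>
    rw [Nat.cast_add, Nat.cast_ofNat, Chebyshev.S_add_two, add_comm n 2]
    have h := (isMonicOfDegree_X R).mul ihn1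
    push_cast at h
    rw [show 1 + (n + 1) = 2 + n by ring] at h
    exact h.sub (by rw [ihn.natDegree_eq]; omega)

theorem isMonicOfDegree_chebyshevV [Nontrivial R] (n : ℕ) :
    IsMonicOfDegree (chebyshevV R n) n := by
  rcases n with _ | n
  · simp [chebyshevV_zero]
  · rw [chebyshevV, Nat.cast_succ, add_sub_cancel_right]
    exact (isMonicOfDegree_chebyshevS R (n + 1)).sub
      (by rw [(isMonicOfDegree_chebyshevS R n).natDegree_eq]; omega)

theorem chebyshevS_add_sub_chebyshevS_sub (m n : ℤ) :
    Chebyshev.S R (m + n) - Chebyshev.S R (m - n) =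
      Chebyshev.S R (n - 1) * Chebyshev.C R (m + 1) := by
  induction n using Chebyshev.induct with
  | zero => simp
  | one =>
    rw [sub_self, Chebyshev.S_zero, one_mul, Chebyshev.C_eq_S_sub_X_mul_S, Chebyshev.S_add_one,
      add_sub_cancel_right]
    ring
  | add_two n ih1 ih2 =>
    have h₁ := Chebyshev.S_add_two R (m + n)
    have h₂ := Chebyshev.S_sub_two R (m - n)
    have h₃ := Chebyshev.S_add_one R n
    linear_combination (norm := ring_nf)
      h₁ - h₂ - Chebyshev.C R (m + 1) * h₃ + (X : R[X]) * ih1 - ih2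
  | neg_add_one n ih1 ih2 =>
    have h₁ := Chebyshev.S_add_two R (m + (-n - 1))
    have h₂ := Chebyshev.S_sub_two R (m - (-n - 1))
    have h₃ := Chebyshev.S_add_two R (-n - 2)
    linear_combination (norm := ring_nf)
      h₁ - h₂ - Chebyshev.C R (m + 1) * h₃ + (X : R[X]) * ih1 - ih2

theorem chebyshevV_add_sub_chebyshevV_sub (m n : ℤ) :
    chebyshevV R (m + n) - chebyshevV R (m - n) =
      Chebyshev.S R (n - 1) * (Chebyshev.C R (m + 1) - Chebyshev.C R m) := by
  have h := chebyshevS_add_sub_chebyshevS_sub R m n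
  have h' := chebyshevS_add_sub_chebyshevS_sub R (m - 1) n
  rw [sub_add_cancel] at h'
  rw [chebyshevV, chebyshevV, sub_right_comm m n, ← sub_add_eq_add_sub m 1 n]
  linear_combination h - h'

variable {R}

/-- The coefficient of `S_{d-1}` in the reduction of `V_{qd+r}`, where `r < d`, modulo
`(X - y) S_{d-1}`; see `dvd_chebyshevV_sub`. -/
noncomputable def residueCoeff (y : R) (d : ℕ) : ℕ → ℕ → R
  | 0, _ => 0
  | 1, r => (Chebyshev.C R (r + 1)).eval y - (Chebyshev.C R r).eval y
  | q + 2, r => residueCoeff y d q r + ((Chebyshev.C R ((q + 1) * d + r + 1)).eval y -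
      (Chebyshev.C R ((q + 1) * d + r)).eval y)

theorem dvd_chebyshevV_add_sub (y : R) (d : ℕ) (m : ℤ) :
    (X - C y) * Chebyshev.S R (d - 1) ∣ chebyshevV R (m + d) - (chebyshevV R (m - d) +
      ((Chebyshev.C R (m + 1)).eval y - (Chebyshev.C R m).eval y) • Chebyshev.S R (d - 1)) := by
  have h := X_sub_C_dvd_sub_C_eval (a := y) (p := Chebyshev.C R (m + 1) - Chebyshev.C R m)
  rw [eval_sub] at h
  convert mul_dvd_mul_right h (Chebyshev.S R (d - 1)) using 1
  rw [smul_eq_C_mul]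
  linear_combination chebyshevV_add_sub_chebyshevV_sub R m d

theorem dvd_chebyshevV_sub (y : R) {d : ℕ} (q : ℕ) (r : Fin d) :
    (X - C y) * Chebyshev.S R (d - 1) ∣ chebyshevV R (q * d + r) -
      (chebyshevV R ((Fin.revPerm ^ q) r : Fin d) +
        residueCoeff y d q r • Chebyshev.S R (d - 1)) := by
  induction q using Nat.twoStepInduction with
  | zero => simp [residueCoeff]
  | one =>
    have h := dvd_chebyshevV_add_sub y d r
    have hrev : ((r.rev : ℕ) : ℤ) = -1 - (r - d) := by
      rw [Fin.val_rev]
      omega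
    rwa [pow_one, Fin.revPerm_apply, hrev, chebyshevV_neg_one_sub, residueCoeff, Nat.cast_one,
      one_mul, add_comm (d : ℤ)]
  | more q ih _ =>
    have hrev : (Fin.revPerm ^ (q + 2) : Equiv.Perm (Fin d)) r = (Fin.revPerm ^ q) r := by
      simp [pow_succ]
    have h := dvd_chebyshevV_add_sub y d ((q + 1) * d + r)
    rw [hrev, residueCoeff]
    convert dvd_add h ih using 1
    push_cast
    rw [show ((q : ℤ) + 1) * d + r + d = (q + 2) * d + r by ring,
      show ((q : ℤ) + 1) * d + r - d = q * d + r by ring, add_smul]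
    ring

theorem eval_chebyshevC_mul (y : R) (m n : ℤ) :
    (Chebyshev.C R (m * n)).eval y = (Chebyshev.C R m).eval ((Chebyshev.C R n).eval y) := by
  rw [Chebyshev.C_mul, eval_comp]

theorem one_add_sum_residueCoeff (y : R) (d q : ℕ) :
    1 + ∑ r ∈ Finset.range d, residueCoeff y d q r =
      (chebyshevV R q).eval ((Chebyshev.C R d).eval y) := by
  have htelescope (m : ℤ) : ∑ r ∈ Finset.range d, ((Chebyshev.C R (m + r + 1)).eval y -
      (Chebyshev.C R (m + r)).eval y) =
      (Chebyshev.C R (m + d)).eval y - (Chebyshev.C R m).eval y := by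
    simpa [add_assoc] using Finset.sum_range_sub (fun r : ℕ => (Chebyshev.C R (m + r)).eval y) d
  induction q using Nat.twoStepInduction with
  | zero => simp [residueCoeff, chebyshevV_zero]
  | one =>
    have h := htelescope 0
    simp only [zero_add, Chebyshev.C_zero, eval_ofNat] at h
    simp only [residueCoeff, h, Nat.cast_one, chebyshevV_one, eval_sub, eval_X, eval_one]
    ring
  | more q ih _ =>
    have hV := congrArg (eval ((Chebyshev.C R d).eval y))
      (chebyshevV_add_sub_chebyshevV_sub R (q + 1) 1)
    simp only [add_sub_cancel_right, eval_sub, sub_self, Chebyshev.S_zero, one_mul,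
      ← eval_chebyshevC_mul] at hV
    simp only [residueCoeff, Finset.sum_add_distrib, htelescope, Nat.cast_add, Nat.cast_ofNat]
    linear_combination (norm := ring_nf) ih - hV

theorem residueCoeff_succ_zero_sub (y : R) (k q : ℕ) :
    residueCoeff y (k + 1) (q + 1) 0 - residueCoeff y (k + 1) q k =
      (y - 2) * (Chebyshev.S R q).eval ((Chebyshev.C R (k + 1)).eval y) := by
  induction q using Nat.twoStepInduction with
  | zero => simp [residueCoeff]
  | one =>
    have hC := congrArg (eval y) (Chebyshev.C_add_one R (k + 1))
    simp only [eval_sub, eval_mul, eval_X] at hC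
    simp only [residueCoeff, Nat.cast_zero, Nat.cast_one, Nat.cast_add, Chebyshev.S_one, eval_X]
    linear_combination (norm := ring_nf) hC
  | more q ih _ =>
    have hC := congrArg (eval y) (Chebyshev.C_add_one R ((q + 2) * (k + 1)))
    have hS := congrArg (eval ((Chebyshev.C R (k + 1)).eval y))
      (chebyshevS_add_sub_chebyshevS_sub R (q + 1) 1)
    simp only [eval_sub, eval_mul, eval_X] at hC
    simp only [add_sub_cancel_right, eval_sub, sub_self, Chebyshev.S_zero, one_mul,
      ← eval_chebyshevC_mul] at hS
    simp only [residueCoeff, Nat.cast_zero, Nat.cast_one, Nat.cast_add, Nat.cast_ofNat]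
    linear_combination (norm := ring_nf) ih + hC - (y - 2) * hS

end Chebyshev

section RankOneShift

variable {ι R : Type*} [DecidableEq ι] [CommRing R]

theorem det_eq_mul_det_updateRow [Fintype ι] (M : Matrix ι ι R) {i₀ i₁ : ι} (h : i₀ ≠ i₁) (c : R)
    (v : ι → R) (hM : M i₀ = M i₁ + c • v) : M.det = c * (M.updateRow i₀ v).det := by
  calc M.det = (M.updateRow i₀ (M i₁ + c • v)).det := by rw [← hM, Matrix.updateRow_eq_self]
    _ = c * (M.updateRow i₀ v).det := by
      rw [Matrix.det_updateRow_add, Matrix.det_updateRow_smul, Matrix.det_updateRow_eq_zero h.symm,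
        zero_add]

/-- The 0-1-matrix of the map `σ`, with the constant `a i` added to all of row `i`. -/
def rankOneShift (σ : ι → ι) (a : ι → R) : Matrix ι ι R :=
  Matrix.of fun i j => (if σ i = j then 1 else 0) + a i

theorem rankOneShift_row_eq (σ : ι → ι) (a : ι → R) {i₀ i₁ : ι} (hσ : σ i₀ = σ i₁) :
    rankOneShift σ a i₀ = rankOneShift σ a i₁ + (a i₀ - a i₁) • 1 := by
  ext j
  simp [rankOneShift, hσ]

variable [Fintype ι]

theorem det_rankOneShift_perm (π : Equiv.Perm ι) (a : ι → R) :
    (rankOneShift π a).det = Equiv.Perm.sign π * (1 + ∑ i, a i) := by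
  have h : rankOneShift π a =
      (1 + Matrix.replicateCol Unit (fun i => a (π.symm i)) *
        Matrix.replicateRow Unit (1 : ι → R)).submatrix π id := by
    ext i j
    simp [rankOneShift, Matrix.mul_apply, Matrix.one_apply]
  rw [h, Matrix.det_permute, Matrix.det_one_add_replicateCol_mul_replicateRow]
  simp [dotProduct, Equiv.sum_comp π.symm a]

theorem det_updateRow_rankOneShift_perm (π : Equiv.Perm ι) (a : ι → R) (i₀ : ι) :
    ((rankOneShift π a).updateRow i₀ 1).det = Equiv.Perm.sign π := by
  have hrow : rankOneShift π (Function.update a i₀ (a i₀ + 1)) =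
      (rankOneShift π a).updateRow i₀ (rankOneShift π a i₀ + 1) := by
    ext i j
    by_cases hi : i = i₀
    · subst hi
      simp [rankOneShift, add_assoc]
    · simp [rankOneShift, hi]
  have hdet := congrArg Matrix.det hrow
  rw [Matrix.det_updateRow_add, Matrix.updateRow_eq_self, det_rankOneShift_perm,
    det_rankOneShift_perm, Finset.sum_update_of_mem (Finset.mem_univ _),
    ← Finset.add_sum_erase _ a (Finset.mem_univ i₀), Finset.sdiff_singleton_eq_erase] at hdet
  linear_combination -hdet

theorem det_rankOneShift_of_eqOn (π : Equiv.Perm ι) (σ : ι → ι) (a : ι → R) {i₀ i₁ : ι}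
    (h : i₀ ≠ i₁) (h₀ : σ i₀ = σ i₁) (hσ : ∀ i, i ≠ i₀ → σ i = π i) :
    (rankOneShift σ a).det = Equiv.Perm.sign π * (a i₀ - a i₁) := by
  have hupdate : (rankOneShift σ a).updateRow i₀ 1 = (rankOneShift π a).updateRow i₀ 1 := by
    ext i j
    by_cases hi : i = i₀
    · simp [hi]
    · simp [Matrix.updateRow_ne hi, rankOneShift, hσ i hi]
  rw [det_eq_mul_det_updateRow _ h _ _ (rankOneShift_row_eq σ a h₀), hupdate,
    det_updateRow_rankOneShift_perm, mul_comm]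

theorem det_rankOneShift_eq_zero (σ : ι → ι) (a : ι → R) {i₀ i₁ i₂ i₃ : ι} (h₀₁ : i₀ ≠ i₁)
    (h₂₃ : i₂ ≠ i₃) (h₀₂ : i₀ ≠ i₂) (h₀₃ : i₀ ≠ i₃) (hσ₀₁ : σ i₀ = σ i₁) (hσ₂₃ : σ i₂ = σ i₃) :
    (rankOneShift σ a).det = 0 := by
  rw [det_eq_mul_det_updateRow _ h₀₁ _ _ (rankOneShift_row_eq σ a hσ₀₁),
    det_eq_mul_det_updateRow _ h₂₃ (a i₂ - a i₃) 1, Matrix.det_zero_of_row_eq h₀₂, mul_zero,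
    mul_zero]
  · ext j
    simp [Matrix.updateRow_ne h₀₂]
  · rw [Matrix.updateRow_ne h₀₂.symm, Matrix.updateRow_ne h₀₃.symm, rankOneShift_row_eq σ a hσ₂₃]

end RankOneShift

theorem sign_revPerm (n : ℕ) :
    Equiv.Perm.sign (Fin.revPerm : Equiv.Perm (Fin n)) = (-1) ^ n.choose 2 := by
  induction n with
  | zero => simp [Subsingleton.elim (Fin.revPerm : Equiv.Perm (Fin 0)) 1]
  | succ n ih =>
    have h : Equiv.Perm.decomposeFin.symm (0, (Fin.revPerm : Equiv.Perm (Fin n))) =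
        finRotate (n + 1) * Fin.revPerm := by
      ext i
      refine Fin.cases ?_ (fun i => ?_) i
      · simp
      · simp [Fin.rev_succ]
    have hsign := congrArg Equiv.Perm.sign h
    rw [Equiv.Perm.decomposeFin.symm_sign, if_pos rfl, one_mul, ih, map_mul, sign_finRotate,
      Nat.succ_sub_one] at hsign
    rw [Nat.choose_succ_succ' n 1, Nat.choose_one_right, pow_add, hsign, ← mul_assoc, ← mul_pow]
    simp

section Residues

open Polynomial

variable {R : Type*} [CommRing R]

/-- The index in `{0, …, k}` to which `m` is moved by reflections in `j ↦ -1 - j` and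
`j ↦ 2k + 1 - j`, which fix the polynomials `V_j` modulo `S_k`. -/
def foldIndex (k m : ℕ) : Fin (k + 1) :=
  (Fin.revPerm ^ (m / (k + 1)) : Equiv.Perm (Fin (k + 1))) (Fin.ofNat (k + 1) m)

theorem foldIndex_mul_add (k q : ℕ) (r : Fin (k + 1)) :
    foldIndex k (q * (k + 1) + r) = (Fin.revPerm ^ q : Equiv.Perm (Fin (k + 1))) r := by
  have hdiv : (q * (k + 1) + r) / (k + 1) = q := by
    rw [mul_comm, Nat.mul_add_div k.succ_pos, Nat.div_eq_of_lt r.2, add_zero]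
  rw [foldIndex, hdiv]
  congr 1
  ext
  simp [Nat.mod_eq_of_lt r.2]

theorem foldIndex_reflect (k q : ℕ) (r : Fin (k + 1)) :
    foldIndex k ((q + 1) * (k + 1) + r) = foldIndex k (q * (k + 1) + r.rev) := by
  rw [foldIndex_mul_add, foldIndex_mul_add, pow_succ, Equiv.Perm.mul_apply, Fin.revPerm_apply]

/-- The matrix of the residues of `V_n, …, V_{n+k}` modulo `(X - y) S_k`, with respect to
`V_0, …, V_k`. -/
noncomputable def residueMatrix (y : R) (k n : ℕ) : Matrix (Fin (k + 1)) (Fin (k + 1)) R :=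
  rankOneShift (fun i => foldIndex k (n + i))
    fun i => residueCoeff y (k + 1) ((n + i) / (k + 1)) ((n + i) % (k + 1))

theorem dvd_chebyshevV_sub_sum_residueMatrix (y : R) (k n : ℕ) (i : Fin (k + 1)) :
    (X - C y) * Chebyshev.S R k ∣
      chebyshevV R (n + i) - ∑ j, residueMatrix y k n i j • chebyshevV R (j : ℕ) := by
  have h := dvd_chebyshevV_sub y ((n + i) / (k + 1)) (Fin.ofNat (k + 1) (n + i))
  have hsum := sum_range_chebyshevV R (k + 1)
  have hdivMod : (((n + i) / (k + 1) : ℕ) : ℤ) * (k + 1 : ℕ) + (Fin.ofNat (k + 1) (n + i) : ℕ) =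
      n + i := by
    exact_mod_cast Nat.div_add_mod' (n + i) (k + 1)
  rw [hdivMod, Nat.cast_succ, add_sub_cancel_right] at h
  rw [Nat.cast_succ, add_sub_cancel_right] at hsum
  convert h using 2
  rw [← hsum, ← Fin.sum_univ_eq_sum_range (fun i => chebyshevV R i)]
  simp only [residueMatrix, rankOneShift, Matrix.of_apply, add_smul, Finset.sum_add_distrib,
    Finset.smul_sum, ite_smul, one_smul, zero_smul, Finset.sum_ite_eq, Finset.mem_univ, if_true]
  rfl

theorem residueCoeff_div_mod (y : R) {d q r : ℕ} (hr : r < d) :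
    residueCoeff y d ((q * d + r) / d) ((q * d + r) % d) = residueCoeff y d q r := by
  rw [mul_comm, Nat.mul_add_mod, Nat.mod_eq_of_lt hr, Nat.mul_add_div (Nat.zero_lt_of_lt hr),
    Nat.div_eq_of_lt hr, add_zero]

theorem det_residueMatrix_mul (y : R) (k q : ℕ) :
    (residueMatrix y k (q * (k + 1))).det =
      Equiv.Perm.sign (Fin.revPerm ^ q : Equiv.Perm (Fin (k + 1))) *
        (chebyshevV R q).eval ((Chebyshev.C R (k + 1)).eval y) := by
  have hone := one_add_sum_residueCoeff y (k + 1) q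
  rw [Nat.cast_succ] at hone
  rw [residueMatrix, funext (foldIndex_mul_add k q), det_rankOneShift_perm, ← hone,
    ← Fin.sum_univ_eq_sum_range]
  simp only [residueCoeff_div_mod y (Fin.is_lt _)]

theorem det_residueMatrix_mul_add_one (y : R) {k : ℕ} (hk : 0 < k) (q : ℕ) :
    (residueMatrix y k (q * (k + 1) + 1)).det =
      Equiv.Perm.sign (Fin.revPerm ^ q * finRotate (k + 1) : Equiv.Perm (Fin (k + 1))) *
        ((y - 2) * (Chebyshev.S R q).eval ((Chebyshev.C R (k + 1)).eval y)) := by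
  have hlast : q * (k + 1) + 1 + (Fin.last k : ℕ) = (q + 1) * (k + 1) + (0 : Fin (k + 1)) := by
    simp only [Fin.val_last, Fin.val_zero]
    ring
  have hpred : q * (k + 1) + 1 + (k - 1) = q * (k + 1) + Fin.last k := by
    simp only [Fin.val_last]
    omega
  rw [residueMatrix, det_rankOneShift_of_eqOn (Fin.revPerm ^ q * finRotate (k + 1)) _ _
    (i₀ := Fin.last k) (i₁ := ⟨k - 1, by omega⟩)]
  · simp only [hlast, hpred, residueCoeff_div_mod y (Fin.is_lt _), ← residueCoeff_succ_zero_sub]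
    rfl
  · simp only [ne_eq, Fin.ext_iff, Fin.val_last]
    omega
  · rw [hlast, hpred, foldIndex_reflect, Fin.rev_zero]
  · intro i hi
    have hrotate : q * (k + 1) + 1 + i = q * (k + 1) + finRotate (k + 1) i := by
      rw [coe_finRotate_of_ne_last hi]
      ring
    rw [hrotate, foldIndex_mul_add, Equiv.Perm.mul_apply]

theorem det_residueMatrix_mul_add_self (y : R) {k : ℕ} (hk : 0 < k) (q : ℕ) :
    (residueMatrix y k (q * (k + 1) + k)).det =
      Equiv.Perm.sign (Fin.revPerm ^ (q + 1) * (finRotate (k + 1))⁻¹ :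
        Equiv.Perm (Fin (k + 1))) *
        -((y - 2) * (Chebyshev.S R q).eval ((Chebyshev.C R (k + 1)).eval y)) := by
  have hzero : q * (k + 1) + k + (0 : Fin (k + 1)) = q * (k + 1) + Fin.last k := by simp
  have hsucc (i : ℕ) : q * (k + 1) + k + (i + 1) = (q + 1) * (k + 1) + i := by ring
  rw [residueMatrix, det_rankOneShift_of_eqOn (Fin.revPerm ^ (q + 1) * (finRotate (k + 1))⁻¹) _ _
    (i₀ := 0) (i₁ := ⟨0 + 1, by omega⟩)]
  · simp only [hzero, hsucc, residueCoeff_div_mod y k.succ_pos,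
      residueCoeff_div_mod y (Fin.is_lt _), ← residueCoeff_succ_zero_sub, neg_sub]
    rfl
  · simp [Fin.ext_iff]
  · rw [hzero, hsucc]
    exact (foldIndex_reflect k q 0).symm
  · intro i hi
    obtain ⟨j, rfl⟩ := Fin.exists_succ_eq.2 hi
    have hrotate : (finRotate (k + 1))⁻¹ j.succ = j.castSucc := by
      rw [Equiv.Perm.inv_eq_iff_eq, finRotate_apply, Fin.coeSucc_eq_succ]
    rw [Equiv.Perm.mul_apply, hrotate, ← foldIndex_mul_add, Fin.val_succ, hsucc, Fin.val_castSucc]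

theorem det_residueMatrix_eq_zero (y : R) {k r : ℕ} (hr : 2 ≤ r) (hrk : r < k) (q : ℕ) :
    (residueMatrix y k (q * (k + 1) + r)).det = 0 := by
  have hreflect (i : ℕ) (hi : i < r) (hi' : i ≤ k - r) :
      foldIndex k (q * (k + 1) + r + (k - r - i)) =
        foldIndex k (q * (k + 1) + r + (k - r + 1 + i)) := by
    have h := foldIndex_reflect k q ⟨i, by omega⟩
    rw [Fin.val_rev] at h
    convert h.symm using 2
    · dsimp only
      omega
    · rw [add_mul]
      dsimp only
      omega
  rw [residueMatrix, det_rankOneShift_eq_zero _ _ (i₀ := ⟨k - r, by omega⟩)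
    (i₁ := ⟨k - r + 1, by omega⟩) (i₂ := ⟨k - r - 1, by omega⟩) (i₃ := ⟨k - r + 2, by omega⟩)]
  iterate 4 simp only [ne_eq, Fin.mk.injEq]; omega
  · exact hreflect 0 (by omega) (by omega)
  · exact hreflect 1 (by omega) (by omega)

theorem sign_revPerm_pow (q d : ℕ) :
    ((Equiv.Perm.sign (Fin.revPerm ^ q : Equiv.Perm (Fin d)) : ℤ) : R) =
      (-1) ^ (q * d.choose 2) := by
  rw [map_pow, sign_revPerm]
  push_cast
  rw [← pow_mul, mul_comm]

theorem neg_one_pow_mul_mul_neg_one_pow_choose_two (q d : ℕ) :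
    (-1 : R) ^ (q * d * d) * (-1) ^ (q * d.choose 2) = (-1) ^ (q * (d + 1).choose 2) := by
  have hparity : (-1 : R) ^ (q * d * d) = (-1) ^ (q * d) :=
    neg_one_pow_congr (by simp [Nat.even_mul])
  rw [hparity, ← pow_add, ← mul_add, Nat.choose_succ_succ' d 1, Nat.choose_one_right]

theorem neg_one_pow_mul_det_residueMatrix_mul (y : R) (k q : ℕ) :
    (-1) ^ (q * (k + 1) * (k + 1)) * (residueMatrix y k (q * (k + 1))).det =
      (-1) ^ (q * (k + 2).choose 2) *
        (chebyshevV R q).eval ((Chebyshev.C R (k + 1)).eval y) := by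
  rw [det_residueMatrix_mul, sign_revPerm_pow, ← mul_assoc,
    neg_one_pow_mul_mul_neg_one_pow_choose_two]

theorem neg_one_pow_mul_det_residueMatrix_mul_add_one (y : R) {k : ℕ} (hk : 0 < k) (q : ℕ) :
    (-1) ^ ((q * (k + 1) + 1) * (k + 1)) * (residueMatrix y k (q * (k + 1) + 1)).det =
      (-1) ^ (q * (k + 2).choose 2) *
        ((2 - y) * (Chebyshev.S R q).eval ((Chebyshev.C R (k + 1)).eval y)) := by
  have hk1 : (-1 : R) ^ (k + 1) * (-1) ^ k = -1 := by
    rw [← pow_add, (Odd.neg_one_pow ⟨k, by ring⟩)]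
  rw [det_residueMatrix_mul_add_one y hk, map_mul, sign_finRotate, Units.val_mul, Int.cast_mul,
    sign_revPerm_pow,
    ← neg_one_pow_mul_mul_neg_one_pow_choose_two q (k + 1), add_one_mul _ (k + 1), pow_add,
    Nat.add_sub_cancel]
  push_cast
  linear_combination (-1 : R) ^ (q * (k + 1) * (k + 1)) * (-1) ^ (q * (k + 1).choose 2) *
    ((y - 2) * (Chebyshev.S R q).eval ((Chebyshev.C R (k + 1)).eval y)) * hk1

theorem neg_one_pow_mul_det_residueMatrix_mul_add_self (y : R) {k : ℕ} (hk : 0 < k) (q : ℕ) :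
    (-1) ^ ((q * (k + 1) + k) * (k + 1)) * (residueMatrix y k (q * (k + 1) + k)).det =
      (-1) ^ ((q + 1) * (k + 2).choose 2) *
        ((y - 2) * (Chebyshev.S R q).eval ((Chebyshev.C R (k + 1)).eval y)) := by
  have hk1 : (-1 : R) ^ ((q * (k + 1) + k) * (k + 1)) * (-1) ^ k * -1 =
      (-1) ^ ((q + 1) * (k + 1) * (k + 1)) := by
    rw [mul_assoc, ← pow_succ, ← pow_add]
    congr 1
    ring
  rw [det_residueMatrix_mul_add_self y hk, map_mul, Equiv.Perm.sign_inv, sign_finRotate,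
    Units.val_mul, Int.cast_mul, sign_revPerm_pow,
    ← neg_one_pow_mul_mul_neg_one_pow_choose_two (q + 1) (k + 1), ← hk1, Nat.add_sub_cancel]
  push_cast
  ring

end Residues

open Polynomial in
theorem det_hankel_chebyshevS_mul {R : Type*} [CommRing R] {L : R[X] →ₗ[R] R} {y : R}
    (hL : ∀ n j : ℕ, j < n → L (chebyshevV R n * (X - C y) ^ j) = 0)
    (hL' : ∀ n : ℕ, L (chebyshevV R n * (X - C y) ^ n) = 1) (k n : ℕ) :
    (Matrix.of fun i j : Fin n =>
        L (Chebyshev.S R k * (X - C y) ^ ((i : ℕ) + (j : ℕ) + 1))).det =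
      (-1) ^ (n * (k + 1)) * (residueMatrix y k n).det := by
  nontriviality R
  let φ (j : ℕ) : R[X] →ₗ[R] R := L ∘ₗ LinearMap.mulRight R ((X - C y) ^ j)
  have hq : IsMonicOfDegree ((X - C y) * Chebyshev.S R k) (k + 1) := by
    rw [add_comm]
    exact (isMonicOfDegree_X_sub_one y).mul (isMonicOfDegree_chebyshevS R k)
  have hshift := det_apply_eq_det_apply_X_pow
    (fun j : Fin n => φ j ∘ₗ LinearMap.mulLeft R ((X - C y) * Chebyshev.S R k))
    (p := fun i => (X - C y) ^ (i : ℕ)) fun i => by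
      simpa using (isMonicOfDegree_X_sub_one y).pow i
  have hdet := det_apply_mul_X_pow (φ := φ) (fun i => isMonicOfDegree_chebyshevV R i) hL hL' hq n
    (M := residueMatrix y k n) fun i => dvd_chebyshevV_sub_sum_residueMatrix y k n i
  rw [← hdet]
  refine Eq.trans (congrArg Matrix.det ?_) hshift
  ext i j
  simp only [Matrix.of_apply, φ, LinearMap.comp_apply, LinearMap.mulLeft_apply,
    LinearMap.mulRight_apply]
  congr 1
  ring

section Paths

/-- The number of three-step paths with `m` steps that start at height `h` and never become
negative. -/
def pathCount (m : ℕ) (h : ℤ) : ℕ :=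
  Fintype.card {s : Fin m → SignType //
    ∀ j : Fin (m + 1), 0 ≤ h + ∑ i ∈ Finset.univ.filter (fun i : Fin m => i.val < j.val), (s i : ℤ)}

theorem motzkinPrefix_eq_pathCount (m k : ℕ) : motzkinPrefix m k = pathCount m k := rfl

theorem pathCount_of_neg (m : ℕ) {h : ℤ} (hh : h < 0) : pathCount m h = 0 := by
  rw [pathCount, Fintype.card_eq_zero_iff]
  refine ⟨fun s => hh.not_ge ?_⟩
  simpa using s.2 0

theorem pathCount_zero {h : ℤ} (hh : 0 ≤ h) : pathCount 0 h = 1 := by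
  rw [pathCount, Fintype.card_eq_one_iff]
  exact ⟨⟨Fin.elim0, fun j => by simpa using hh⟩, fun y => Subtype.ext (Subsingleton.elim _ _)⟩

theorem sum_filter_cons {m : ℕ} (a : SignType) (s : Fin m → SignType) (j : ℕ) :
    ∑ i ∈ Finset.univ.filter (fun i : Fin (m + 1) => i.val < j + 1),
      ((Fin.cons a s : Fin (m + 1) → SignType) i : ℤ) =
      a + ∑ i ∈ Finset.univ.filter (fun i : Fin m => i.val < j), (s i : ℤ) := by
  simp [Finset.sum_filter, Fin.sum_univ_succ]

theorem pathCount_succ_eq_sum (m : ℕ) {h : ℤ} (hh : 0 ≤ h) :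
    pathCount (m + 1) h = ∑ a : SignType, pathCount m (h + a) := by
  unfold pathCount
  rw [← Fintype.card_sigma]
  refine Fintype.card_congr
    { toFun := fun s => ⟨s.1 0, Fin.tail s.1, fun j => ?_⟩
      invFun := fun p => ⟨Fin.cons p.1 p.2.1, fun j => ?_⟩
      left_inv := fun s => Subtype.ext (Fin.cons_self_tail _)
      right_inv := fun _ => rfl }
  · have hheight := s.2 j.succ
    rw [← Fin.cons_self_tail s.1, Fin.val_succ, sum_filter_cons] at hheight
    simpa [add_assoc] using hheight
  · refine Fin.cases (by simpa using hh) (fun j => ?_) j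
    rw [Fin.val_succ, sum_filter_cons, ← add_assoc]
    exact p.2.2 j

theorem pathCount_succ (m : ℕ) {h : ℤ} (hh : 0 ≤ h) :
    pathCount (m + 1) h = pathCount m (h - 1) + pathCount m h + pathCount m (h + 1) := by
  have huniv : (Finset.univ : Finset SignType) = {-1, 0, 1} := by decide
  rw [pathCount_succ_eq_sum m hh, huniv, Finset.sum_insert (by decide),
    Finset.sum_insert (by decide), Finset.sum_singleton]
  simp [← sub_eq_add_neg, add_assoc]

theorem pathCount_eq_three_pow {m : ℕ} {h : ℤ} (hm : m ≤ h) : pathCount m h = 3 ^ m := by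
  induction m generalizing h with
  | zero => exact pathCount_zero (by simpa using hm)
  | succ m ih =>
    rw [pathCount_succ m (by omega), ih (by omega), ih (by omega), ih (by omega)]
    ring

theorem pathCount_sub_one_add_one (m : ℕ) : pathCount m (m - 1) + 1 = 3 ^ m := by
  induction m with
  | zero => simp [pathCount_of_neg]
  | succ m ih =>
    rw [Nat.cast_succ, add_sub_cancel_right, pathCount_succ m m.cast_nonneg,
      pathCount_eq_three_pow le_rfl, pathCount_eq_three_pow (h := m + 1) (by omega), pow_succ]
    omega

theorem trinomial_natCast (n a b : ℕ) :
    trinomial n a b = n.choose (a + b) * (a + b).choose a := by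
  unfold trinomial
  split_ifs with h
  · have hab : a + b ≤ n := by omega
    have hrest : ((n : ℤ) - a - b).toNat = n - (a + b) := by omega
    rw [hrest, Int.toNat_natCast, Int.toNat_natCast]
    refine Nat.div_eq_of_eq_mul_left (by positivity) ?_
    rw [← Nat.choose_mul_factorial_mul_factorial hab,
      ← Nat.choose_mul_factorial_mul_factorial (Nat.le_add_right a b), Nat.add_sub_cancel_left]
    ring
  · rw [Nat.choose_eq_zero_of_lt (by omega), zero_mul]

theorem trinomial_of_neg_left (n : ℕ) {a : ℤ} (b : ℤ) (ha : a < 0) : trinomial n a b = 0 :=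
  if_neg (by omega)

theorem trinomial_of_neg_right (n : ℕ) (a : ℤ) {b : ℤ} (hb : b < 0) : trinomial n a b = 0 :=
  if_neg (by omega)

theorem trinomial_of_lt {n : ℕ} {a : ℤ} (b : ℤ) (ha : n < a) : trinomial n a b = 0 :=
  if_neg (by omega)

theorem trinomial_succ (n : ℕ) (a b : ℤ) :
    trinomial (n + 1) a b = trinomial n (a - 1) b + trinomial n a (b - 1) + trinomial n a b := by
  rcases lt_or_ge a 0 with ha | ha
  · simp only [trinomial_of_neg_left _ _ ha, trinomial_of_neg_left _ _ (show a - 1 < 0 by omega)]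
  rcases lt_or_ge b 0 with hb | hb
  · simp only [trinomial_of_neg_right _ _ hb, trinomial_of_neg_right _ _ (show b - 1 < 0 by omega)]
  lift a to ℕ using ha
  lift b to ℕ using hb
  have hpred (c : ℕ) : ((c + 1 : ℕ) : ℤ) - 1 = c := by simp
  have hleft : trinomial n (((0 : ℕ) : ℤ) - 1) b = 0 := trinomial_of_neg_left _ _ (by simp)
  have hright : trinomial n a (((0 : ℕ) : ℤ) - 1) = 0 := trinomial_of_neg_right _ _ (by simp)
  rcases a with _ | a <;> rcases b with _ | b
  · rw [hleft, hright, trinomial_natCast, trinomial_natCast]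
    simp
  · rw [hleft, hpred, trinomial_natCast, trinomial_natCast, trinomial_natCast]
    simp [Nat.choose_succ_succ]
  · rw [hright, hpred, trinomial_natCast, trinomial_natCast, trinomial_natCast]
    simp [Nat.choose_succ_succ]
  · rw [hpred, hpred, trinomial_natCast, trinomial_natCast, trinomial_natCast, trinomial_natCast,
      show a + 1 + (b + 1) = (a + b + 1) + 1 by ring, show a + (b + 1) = a + b + 1 by ring,
      show a + 1 + b = a + b + 1 by ring, Nat.choose_succ_succ n,
      Nat.choose_succ_succ (a + b + 1) a]
    ring

/-- The sum over `r` of the trinomial coefficients of `n` with lower entries `r` and `r + l`, that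
is, the number of three-step walks with `n` steps that rise by `l`. -/
def walkCount (n : ℕ) (l : ℤ) : ℕ := ∑ r ∈ Finset.range (n + 1), trinomial n r (r + l)

theorem walkCount_eq_sum_range {n N : ℕ} (h : n < N) (l : ℤ) :
    walkCount n l = ∑ r ∈ Finset.range N, trinomial n r (r + l) := by
  refine Finset.sum_subset (Finset.range_mono h) fun r _ hr => trinomial_of_lt _ ?_
  rw [Finset.mem_range] at hr
  omega

theorem walkCount_succ (n : ℕ) (l : ℤ) :
    walkCount (n + 1) l = walkCount n (l - 1) + walkCount n l + walkCount n (l + 1) := by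
  have hup : ∑ r ∈ Finset.range (n + 2), trinomial n ((r : ℤ) - 1) (r + l) =
      walkCount n (l + 1) := by
    rw [Finset.sum_range_succ', Nat.cast_zero, trinomial_of_neg_left _ _ (by norm_num), add_zero]
    refine Finset.sum_congr rfl fun r _ => ?_
    congr 1 <;> push_cast <;> ring
  rw [← hup, walkCount_eq_sum_range (show n < n + 2 by omega),
    walkCount_eq_sum_range (show n < n + 2 by omega), walkCount]
  simp only [trinomial_succ, Finset.sum_add_distrib, ← add_sub_assoc]
  ring

theorem trinomialSum_eq_sum_walkCount (n k : ℕ) :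
    trinomialSum n k = ∑ l ∈ Finset.Icc (-(k : ℤ)) (k + 1), walkCount n l := by
  unfold walkCount trinomialSum
  rw [Finset.sum_comm]
  refine finsum_eq_sum_of_support_subset _ fun r hr => ?_
  by_contra hmem
  refine hr (Finset.sum_eq_zero fun l _ => trinomial_of_lt _ ?_)
  rw [Finset.mem_coe, Finset.mem_range] at hmem
  omega

theorem walkCount_zero (l : ℤ) : walkCount 0 l = if l = 0 then 1 else 0 := by
  simp only [walkCount, zero_add, Finset.sum_range_one, Nat.cast_zero]
  split_ifs with h
  · simp [h, trinomial]
  · exact if_neg (by omega)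

theorem sum_walkCount_succ (n : ℕ) {a b : ℤ} (h : a + 2 ≤ b) :
    ∑ l ∈ Finset.Ico a b, walkCount (n + 1) l =
      ∑ l ∈ Finset.Ico (a + 1) (b - 1), walkCount n l + ∑ l ∈ Finset.Ico a b, walkCount n l +
      ∑ l ∈ Finset.Ico (a - 1) (b + 1), walkCount n l := by
  have hconsec {x y z : ℤ} (hxy : x ≤ y) (hyz : y ≤ z) : ∑ l ∈ Finset.Ico x z, walkCount n l =
      ∑ l ∈ Finset.Ico x y, walkCount n l + ∑ l ∈ Finset.Ico y z, walkCount n l := by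
    rw [← Finset.Ico_union_Ico_eq_Ico hxy hyz,
      Finset.sum_union (Finset.Ico_disjoint_Ico_consecutive x y z)]
  have hdown := Finset.sum_Ico_add' (walkCount n) a b (-1)
  have hup := Finset.sum_Ico_add' (walkCount n) a b 1
  simp only [← sub_eq_add_neg] at hdown
  simp only [walkCount_succ, Finset.sum_add_distrib, hdown, hup]
  rw [hconsec (x := a + 1) (y := b - 1) (z := b + 1) (by omega) (by omega),
    hconsec (x := a - 1) (y := b - 1) (z := b + 1) (by omega) (by omega)]
  ring

theorem pathCount_eq_sum_walkCount (n : ℕ) {h : ℤ} (hh : -1 ≤ h) :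
    pathCount n h = ∑ l ∈ Finset.Ico (-h) (h + 2), walkCount n l := by
  induction n generalizing h with
  | zero =>
    rcases hh.eq_or_lt with rfl | hh
    · rw [pathCount_of_neg _ (by norm_num)]
      simp
    · rw [pathCount_zero (by omega)]
      simp only [walkCount_zero, Finset.sum_ite_eq', Finset.mem_Ico]
      rw [if_pos (by omega)]
  | succ n ih =>
    rcases hh.eq_or_lt with rfl | hh
    · rw [pathCount_of_neg _ (by norm_num)]
      simp
    · rw [pathCount_succ n (by omega), sum_walkCount_succ n (by omega), ih (by omega),
        ih (by omega), ih (by omega), show -(h - 1) = -h + 1 by ring,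
        show h - 1 + 2 = h + 2 - 1 by ring, show -(h + 1) = -h - 1 by ring,
        show h + 1 + 2 = h + 2 + 1 by ring]

theorem motzkinPrefix_eq_trinomialSum (n k : ℕ) : motzkinPrefix n k = trinomialSum n k := by
  rw [motzkinPrefix_eq_pathCount, pathCount_eq_sum_walkCount n (by omega),
    trinomialSum_eq_sum_walkCount]
  refine Finset.sum_congr (Finset.ext fun l => ?_) fun _ _ => rfl
  simp only [Finset.mem_Ico, Finset.mem_Icc]
  omega

end Paths

section PathFunctional

open Polynomial

/-- The linear functional `L` on `ℤ[X]` for which `L((X + 1)^m)` is the number of three-step paths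
with `m` steps from height `0`; the polynomials `V_n` are orthonormal with respect to `L`. -/
noncomputable def pathFunctional : ℤ[X] →ₗ[ℤ] ℤ :=
  (basisMonomials ℤ).constr ℤ (fun m => (pathCount m 0 : ℤ)) ∘ₗ taylor (-1)

theorem pathFunctional_X_sub_C_pow (m : ℕ) :
    pathFunctional ((X - C (-1)) ^ m) = pathCount m 0 := by
  have htaylor : taylor (-1) ((X - C (-1)) ^ m : ℤ[X]) = basisMonomials ℤ m := by
    simp [X_pow_eq_monomial]
  rw [pathFunctional, LinearMap.comp_apply, htaylor, Module.Basis.constr_basis]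

theorem pathFunctional_chebyshevS_mul (k m : ℕ) :
    pathFunctional (Chebyshev.S ℤ k * (X - C (-1)) ^ m) = pathCount m k := by
  induction k using Nat.twoStepInduction generalizing m with
  | zero => simpa using pathFunctional_X_sub_C_pow m
  | one =>
    have hpoly : Chebyshev.S ℤ 1 * (X - C (-1)) ^ m =
        (X - C (-1)) ^ (m + 1) - (X - C (-1)) ^ m := by
      rw [Chebyshev.S_one, C_neg, C_1]
      ring
    rw [Nat.cast_one, hpoly, map_sub, pathFunctional_X_sub_C_pow, pathFunctional_X_sub_C_pow,
      pathCount_succ m le_rfl, pathCount_of_neg m (by norm_num)]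
    push_cast
    ring
  | more k ih₀ ih₁ =>
    have hpoly : Chebyshev.S ℤ (k + 2 : ℕ) * (X - C (-1)) ^ m =
        Chebyshev.S ℤ (k + 1 : ℕ) * (X - C (-1)) ^ (m + 1) -
          Chebyshev.S ℤ (k + 1 : ℕ) * (X - C (-1)) ^ m - Chebyshev.S ℤ k * (X - C (-1)) ^ m := by
      push_cast
      rw [Chebyshev.S_add_two, C_neg, C_1]
      ring
    rw [hpoly, map_sub, map_sub, ih₀, ih₁, ih₁, pathCount_succ m (by positivity)]
    push_cast
    ring_nf

theorem pathFunctional_chebyshevV_mul (n m : ℕ) :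
    pathFunctional (chebyshevV ℤ n * (X - C (-1)) ^ m) = pathCount m n - pathCount m (n - 1) := by
  rcases n with _ | n
  · simpa [chebyshevV_zero, pathCount_of_neg] using pathFunctional_X_sub_C_pow m
  · rw [chebyshevV, sub_mul, map_sub, pathFunctional_chebyshevS_mul, Nat.cast_succ,
      add_sub_cancel_right, pathFunctional_chebyshevS_mul]

theorem det_motzkinPrefix (k n : ℕ) :
    (Matrix.of fun i j : Fin n => (motzkinPrefix ((i : ℕ) + (j : ℕ) + 1) k : ℤ)).det =
      (-1) ^ (n * (k + 1)) * (residueMatrix (-1 : ℤ) k n).det := by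
  rw [← det_hankel_chebyshevS_mul (L := pathFunctional) (y := -1) (fun n j hj => ?_) fun n => ?_]
  · simp only [pathFunctional_chebyshevS_mul, motzkinPrefix_eq_pathCount]
  · rw [pathFunctional_chebyshevV_mul, pathCount_eq_three_pow (by omega),
      pathCount_eq_three_pow (by omega), sub_self]
  · rw [pathFunctional_chebyshevV_mul, pathCount_eq_three_pow le_rfl,
      ← pathCount_sub_one_add_one n]
    push_cast
    ring

end PathFunctional

section Evaluation

open Polynomial

variable {R : Type*} [CommRing R]

theorem eval_neg_one_chebyshevC (n : ℕ) :
    (Chebyshev.C R n).eval (-1) = if n % 3 = 0 then 2 else -1 := by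
  induction n using Nat.twoStepInduction with
  | zero => simp
  | one => simp
  | more n ih₀ ih₁ =>
    push_cast at ih₁ ⊢
    rw [Chebyshev.C_add_two, eval_sub, eval_mul, eval_X, ih₀, ih₁]
    split_ifs <;> first | omega | ring

theorem eval_neg_one_chebyshevS (n : ℕ) :
    (Chebyshev.S R n).eval (-1) = if n % 3 = 0 then 1 else if n % 3 = 1 then -1 else 0 := by
  induction n using Nat.twoStepInduction with
  | zero => simp
  | one => simp
  | more n ih₀ ih₁ =>
    push_cast at ih₁ ⊢
    rw [Chebyshev.S_add_two, eval_sub, eval_mul, eval_X, ih₀, ih₁]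
    split_ifs <;> first | omega | ring

theorem eval_neg_one_chebyshevV (n : ℕ) :
    (chebyshevV R n).eval (-1) = if n % 3 = 1 then -2 else 1 := by
  rcases n with _ | n
  · simp [chebyshevV_zero]
  · rw [chebyshevV, eval_sub, Nat.cast_succ, add_sub_cancel_right, ← Nat.cast_succ,
      eval_neg_one_chebyshevS, eval_neg_one_chebyshevS]
    split_ifs <;> first | omega | ring

theorem eval_two_chebyshevV (n : ℤ) : (chebyshevV R n).eval 2 = 1 := by
  simp [chebyshevV, Chebyshev.S_eval_two]

end Evaluation

theorem det_motzkinPrefix_mul_add {k r : ℕ} (hr : r < k + 1) (q : ℕ) :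
    (Matrix.of fun i j : Fin (q * (k + 1) + r) =>
        (motzkinPrefix ((i : ℕ) + (j : ℕ) + 1) k : ℤ)).det =
      if r = 0 then
        (-1) ^ (q * (k + 2).choose 2) *
          (chebyshevV ℤ q).eval ((Polynomial.Chebyshev.C ℤ (k + 1)).eval (-1))
      else if r = 1 then
        3 * (-1) ^ (q * (k + 2).choose 2) *
          (Polynomial.Chebyshev.S ℤ q).eval ((Polynomial.Chebyshev.C ℤ (k + 1)).eval (-1))
      else if r = k then
        -3 * (-1) ^ ((q + 1) * (k + 2).choose 2) *
          (Polynomial.Chebyshev.S ℤ q).eval ((Polynomial.Chebyshev.C ℤ (k + 1)).eval (-1))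
      else 0 := by
  rw [det_motzkinPrefix]
  split_ifs with h₀ h₁ h₂
  · rw [h₀, add_zero, neg_one_pow_mul_det_residueMatrix_mul]
  · rw [h₁, neg_one_pow_mul_det_residueMatrix_mul_add_one _ (by omega)]
    ring
  · rw [h₂, neg_one_pow_mul_det_residueMatrix_mul_add_self _ (by omega)]
    ring
  · rw [det_residueMatrix_eq_zero _ (by omega) (by omega), mul_zero]

theorem det_motzkinPrefix_of_mod_three_eq {k : ℕ} (hk : k % 3 = 2) (n : ℕ) :
    (Matrix.of fun i j : Fin n => (motzkinPrefix ((i : ℕ) + (j : ℕ) + 1) k : ℤ)).det =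
      if n % (k + 1) = 0 then (-1) ^ (n / (k + 1) * (k + 2).choose 2)
      else if n % (k + 1) = 1 then
        3 * (-1) ^ (n / (k + 1) * (k + 2).choose 2) * (((n / (k + 1) : ℕ) : ℤ) + 1)
      else if n % (k + 1) = k then
        3 * (-1) ^ ((n / (k + 1) + 1) * (k + 2).choose 2 + 1) * (((n / (k + 1) : ℕ) : ℤ) + 1)
      else 0 := by
  have hC : (Polynomial.Chebyshev.C ℤ (k + 1)).eval (-1) = 2 := by
    have h := eval_neg_one_chebyshevC (R := ℤ) (k + 1)
    rwa [if_pos (by omega), Nat.cast_succ] at h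
  conv_lhs => rw [← Nat.div_add_mod' n (k + 1)]
  rw [det_motzkinPrefix_mul_add (Nat.mod_lt n k.succ_pos), hC, eval_two_chebyshevV,
    Polynomial.Chebyshev.S_eval_two, mul_one,
    pow_succ _ ((n / (k + 1) + 1) * _), mul_neg_one, mul_neg, neg_mul]
  rfl

theorem neg_one_pow_mul_congr {m n : ℕ} (h : m % 2 = n % 2) (b : ℕ) :
    (-1 : ℤ) ^ (m * b) = (-1) ^ (n * b) :=
  neg_one_pow_congr (by rw [Nat.even_mul, Nat.even_mul, Nat.even_iff, Nat.even_iff (n := n), h])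

theorem exists_eq_three_mul_add_mul_add (n k : ℕ) :
    ∃ p j r, j < 3 ∧ r < k + 1 ∧ n = (3 * p + j) * (k + 1) + r ∧ n / (3 * k + 3) = p ∧
      n % (3 * k + 3) = j * (k + 1) + r := by
  have hdiv : n / (3 * k + 3) = n / (k + 1) / 3 := by
    rw [Nat.div_div_eq_div_mul, add_one_mul, mul_comm k]
  have hq := Nat.div_add_mod (n / (k + 1)) 3
  have hn := Nat.div_add_mod' n (k + 1)
  refine ⟨n / (k + 1) / 3, n / (k + 1) % 3, n % (k + 1), Nat.mod_lt _ three_pos,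
    Nat.mod_lt _ k.succ_pos, by rw [hq, hn], hdiv, ?_⟩
  have hmod := Nat.div_add_mod n (3 * k + 3)
  rw [hdiv] at hmod
  rw [← hq] at hn
  linarith

theorem det_motzkinPrefix_of_mod_three_ne {k : ℕ} (hk : k % 3 ≠ 2) (n : ℕ) :
    (Matrix.of fun i j : Fin n => (motzkinPrefix ((i : ℕ) + (j : ℕ) + 1) k : ℤ)).det =
      if n % (3 * k + 3) = 0 then (-1) ^ (n / (3 * k + 3) * (k + 2).choose 2)
      else if n % (3 * k + 3) = k + 1 then
        2 * (-1) ^ ((n / (3 * k + 3) + 1) * (k + 2).choose 2 + 1)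
      else if n % (3 * k + 3) = 2 * k + 2 then (-1) ^ (n / (3 * k + 3) * (k + 2).choose 2)
      else if n % (3 * k + 3) = 1 then 3 * (-1) ^ (n / (3 * k + 3) * (k + 2).choose 2)
      else if n % (3 * k + 3) = k + 2 then
        3 * (-1) ^ ((n / (3 * k + 3) + 1) * (k + 2).choose 2 + 1)
      else if n % (3 * k + 3) = k then
        3 * (-1) ^ ((n / (3 * k + 3) + 1) * (k + 2).choose 2 + 1)
      else if n % (3 * k + 3) = 2 * k + 1 then
        3 * (-1) ^ (n / (3 * k + 3) * (k + 2).choose 2)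
      else 0 := by
  have hC : (Polynomial.Chebyshev.C ℤ (k + 1)).eval (-1) = -1 := by
    have h := eval_neg_one_chebyshevC (R := ℤ) (k + 1)
    rwa [if_neg (by omega), Nat.cast_succ] at h
  obtain ⟨p, j, r, hj, hr, rfl, hdiv, hmod⟩ := exists_eq_three_mul_add_mul_add n k
  have hj3 : (3 * p + j) % 3 = j := by omega
  have hsign₀ := neg_one_pow_mul_congr (show (3 * p + 0) % 2 = p % 2 by omega) ((k + 2).choose 2)
  have hsign₁ := neg_one_pow_mul_congr (show (3 * p + 1) % 2 = (p + 1) % 2 by omega)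
    ((k + 2).choose 2)
  have hsign₂ := neg_one_pow_mul_congr (show (3 * p + 2) % 2 = p % 2 by omega) ((k + 2).choose 2)
  rw [det_motzkinPrefix_mul_add hr, hC, eval_neg_one_chebyshevV, eval_neg_one_chebyshevS, hj3,
    hmod, hdiv]
  clear hmod hdiv
  have hr' : r = 0 ∨ r = 1 ∧ 0 < k ∨ r = k ∧ 1 < k ∨ 2 ≤ r ∧ r < k := by omega
  rcases hr' with rfl | ⟨rfl, hk0⟩ | ⟨rfl, hk1⟩ | ⟨hr2, hrk⟩
  all_goals
    interval_cases j <;>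
    simp (disch := omega) only [if_pos, if_neg, if_true, add_assoc, Nat.reduceAdd, hsign₀, hsign₁,
      hsign₂] <;>
    ring

theorem corollary16 (n k : ℕ) (hn : 0 < n) :
    (Matrix.of fun i j : Fin n => (motzkinPrefix ((i : ℕ) + (j : ℕ) + 1) k : ℤ)).det =
      (Matrix.of fun i j : Fin n => (trinomialSum ((i : ℕ) + (j : ℕ) + 1) k : ℤ)).det ∧
    (Matrix.of fun i j : Fin n => (motzkinPrefix ((i : ℕ) + (j : ℕ) + 1) k : ℤ)).det =
      if n % (k + 1) = 0 ∧ k % 3 = 2 then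
        (-1) ^ (n / (k + 1) * (k + 2).choose 2)
      else if n % (3 * k + 3) = 0 ∧ k % 3 ≠ 2 then
        (-1) ^ (n / (3 * k + 3) * (k + 2).choose 2)
      else if n % (3 * k + 3) = k + 1 ∧ k % 3 ≠ 2 then
        2 * (-1) ^ ((n / (3 * k + 3) + 1) * (k + 2).choose 2 + 1)
      else if n % (3 * k + 3) = 2 * k + 2 ∧ k % 3 ≠ 2 then
        (-1) ^ (n / (3 * k + 3) * (k + 2).choose 2)
      else if n % (k + 1) = 1 ∧ k % 3 = 2 then
        3 * (-1) ^ (n / (k + 1) * (k + 2).choose 2) * (((n / (k + 1) : ℕ) : ℤ) + 1)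
      else if n % (3 * k + 3) = 1 ∧ k % 3 ≠ 2 then
        3 * (-1) ^ (n / (3 * k + 3) * (k + 2).choose 2)
      else if n % (3 * k + 3) = k + 2 ∧ k % 3 ≠ 2 then
        3 * (-1) ^ ((n / (3 * k + 3) + 1) * (k + 2).choose 2 + 1)
      else if n % (k + 1) = k ∧ k % 3 = 2 then
        3 * (-1) ^ ((n / (k + 1) + 1) * (k + 2).choose 2 + 1) * (((n / (k + 1) : ℕ) : ℤ) + 1)
      else if n % (3 * k + 3) = k ∧ k % 3 ≠ 2 then
        3 * (-1) ^ ((n / (3 * k + 3) + 1) * (k + 2).choose 2 + 1)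
      else if n % (3 * k + 3) = 2 * k + 1 ∧ k % 3 ≠ 2 then
        3 * (-1) ^ (n / (3 * k + 3) * (k + 2).choose 2)
      else 0 := by
  refine ⟨by simp only [motzkinPrefix_eq_trinomialSum], ?_⟩
  by_cases hk : k % 3 = 2
  · simp only [hk, and_true, ne_eq, not_true_eq_false, and_false, if_false]
    exact det_motzkinPrefix_of_mod_three_eq hk n
  · simp only [hk, and_false, if_false, ne_eq, not_false_eq_true, and_true]
    exact det_motzkinPrefix_of_mod_three_ne hk n
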